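/- Let $\Gamma$ be a Fuchsian group (a discrete group of orientation-preserving isometries of the hyperbolic plane $\mathbb H$) without elliptic elements, and suppose that the hyperbolic surface $\Sigma=\Gamma\backslash\mathbb H$ is geometrically infinite, i.e. that no Dirichlet domain of $\Gamma$ is a polygon with finitely many sides. Let $g_t$ and $h_s$ be the geodesic and the horocycle flow on $T^1\Sigma=\Gamma\backslash T^1\mathbb H$, where $h_{\mathbb R}(u)$ is the projection of the set of unit vectors, based on the horocycle through the base point of a lift $\tilde u$ of $u$ centred at the endpoint $\tilde u(+\infty)$, that point towards $\tilde u(+\infty)$. Let $\Omega_h$ be the non-wandering set of $h_{\mathbb R}$: the set of $u\in T^1\Sigma$ such that for every neighbourhood $U$ of $u$ and every $T\in\mathbb R$ there is $s\ge T$ with $h_s(U)\cap U\ne\emptyset$. Let $u_0\in\Omega_h$ be such that the orbit $h_{\mathbb R}(u_0)$ is irregular, i.e. neither closed nor dense in $\Omega_h$, and of infinite asymptotic thinness, i.e. $$\liminf_{t\to+\infty}\operatorname{inj}_\Sigma(u_0(t))=+\infty ,$$ where $u_0(t)$ is the base point of $g_t u_0$ and, for any lift $z\in\mathbb H$ of $x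 \in \Sigma$, $\operatorname{inj}_\Sigma(x)=\tfrac12\inf_{\gamma\in\Gamma\setminus\{\mathrm{Id}\}}d(z,\gamma z)$. Then at least one of the following holds: - $h_{\mathbb R}(u_0)$ is recurrent: there is a sequence of reals $s_n$ with $|s_n|\to\infty$ and $h_{s_n}u_0\to u_0$; - the closure $\overline{h_{\mathbb R}(u_0)}$ is not $h_{\mathbb R}$-minimal, where a set is $h_{\mathbb R}$-minimal if it is closed, nonempty and $h_{\mathbb R}$-invariant and contains no proper closed nonempty $h_{\mathbb R}$-invariant subset. -/

import Mathlib

open scoped MatrixGroups UpperHalfPlane Topology ENNReal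

noncomputable section

namespace Horo

/-! ### Topological dynamics of a one-parameter family of maps -/

section Dynamics

variable {X : Type*} (φ : ℝ → X → X)

/-- The orbit `φ_ℝ(x)`. -/
def orbit (x : X) : Set X := Set.range fun t : ℝ => φ t x

variable [TopologicalSpace X]

/-- The non-wandering set: the points `x` such that every neighbourhood `U` of `x` meets
`φ_t U` for arbitrarily large times `t`. -/
def nonwanderingSet : Set X :=
  {x | ∀ U ∈ 𝓝 x, ∀ T : ℝ, ∃ t : ℝ, T ≤ t ∧ (φ t '' U ∩ U).Nonempty}

/-- The orbit of `x` comes back arbitrarily close to `x` at times of arbitrarily large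
absolute value. -/
def IsRecurrent (x : X) : Prop :=
  ∀ U ∈ 𝓝 x, ∀ T : ℝ, ∃ t : ℝ, T ≤ |t| ∧ φ t x ∈ U

/-- A `φ`-minimal set: closed, nonempty, invariant, and without proper closed nonempty
invariant subset. -/
structure IsMinimalSet (M : Set X) : Prop where
  isClosed : IsClosed M
  nonempty : M.Nonempty
  invariant : IsInvariant φ M
  eq_of_subset : ∀ N : Set X, IsClosed N → N.Nonempty → IsInvariant φ N → N ⊆ M → N = M

/-- The orbit of `x` is irregular: neither closed, nor dense in the non-wandering set. -/
def IsIrregularOrbit (x : X) : Prop :=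
  ¬ IsClosed (orbit φ x) ∧ ¬ nonwanderingSet φ ⊆ closure (orbit φ x)

end Dynamics

/-! ### The unit tangent bundle of the hyperbolic plane -/

/-- A unit tangent vector of `ℍ` for the metric `|dz| / Im z`: a base point `z` and a complex
number `v` with `|v| = Im z`. -/
@[ext]
structure UnitTangent where
  base : ℍ
  vec : ℂ
  norm_vec : ‖vec‖ = base.im

namespace UnitTangent

instance : TopologicalSpace UnitTangent :=
  TopologicalSpace.induced (fun u => (u.base, u.vec)) inferInstance

/-- The denominator `c z + d` of the Möbius transformation `g`. Its derivative at `z` is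
`1 / (c z + d) ^ 2`. -/
def den (g : SL(2, ℝ)) (z : ℍ) : ℂ := ((g 1 0 : ℝ) : ℂ) * z + ((g 1 1 : ℝ) : ℂ)

theorem den_eq (g : SL(2, ℝ)) (z : ℍ) : den g z = UpperHalfPlane.denom g z := by
  simp [den, UpperHalfPlane.denom]

theorem den_ne_zero (g : SL(2, ℝ)) (z : ℍ) : den g z ≠ 0 := by
  rw [den_eq]; exact UpperHalfPlane.denom_ne_zero _ _

theorem coe_smul_eq (g : SL(2, ℝ)) (z : ℍ) :
    ((g • z : ℍ) : ℂ) = (((g 0 0 : ℝ) : ℂ) * z + ((g 0 1 : ℝ) : ℂ)) / den g z := by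
  simpa [den] using UpperHalfPlane.coe_specialLinearGroup_apply g z

theorem det_eq (g : SL(2, ℝ)) : g 0 0 * g 1 1 - g 0 1 * g 1 0 = 1 := by
  have := g.det_coe
  rwa [Matrix.det_fin_two] at this

theorem im_smul_eq (g : SL(2, ℝ)) (z : ℍ) : (g • z : ℍ).im = z.im / ‖den g z‖ ^ 2 := by
  rw [UpperHalfPlane.im, coe_smul_eq, Complex.sq_norm, Complex.div_im]
  have hn : Complex.normSq (den g z) ≠ 0 := by simpa using den_ne_zero g z
  field_simp
  simp [den]
  linear_combination z.im * det_eq g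

theorem den_mul (g h : SL(2, ℝ)) (z : ℍ) : den (g * h) z = den g (h • z) * den h z := by
  have := den_ne_zero h z
  rw [den, den, coe_smul_eq]
  field_simp
  simp [den, Matrix.mul_apply, Fin.sum_univ_two]
  ring

/-- The action of `SL(2, ℝ)` on the unit tangent bundle by differentials of Möbius
transformations. -/
instance : MulAction SL(2, ℝ) UnitTangent where
  smul g u :=
    { base := g • u.base
      vec := u.vec / den g u.base ^ 2
      norm_vec := by rw [norm_div, norm_pow, im_smul_eq, u.norm_vec] }
  one_smul u := by
    ext1
    · exact one_smul _ u.base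
    · change u.vec / den 1 u.base ^ 2 = u.vec
      simp [den]
  mul_smul g h u := by
    ext1
    · exact mul_smul g h u.base
    · change u.vec / den (g * h) u.base ^ 2 = u.vec / den h u.base ^ 2 / den g (h • u.base) ^ 2
      rw [den_mul, mul_pow, div_div, mul_comm]

@[simp] theorem base_smul (g : SL(2, ℝ)) (u : UnitTangent) : (g • u).base = g • u.base := rfl

@[simp] theorem vec_smul (g : SL(2, ℝ)) (u : UnitTangent) :
    (g • u).vec = u.vec / den g u.base ^ 2 := rfl

/-- The vertical unit vector based at `i`, pointing towards `∞`. -/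
def origin : UnitTangent where
  base := UpperHalfPlane.I
  vec := Complex.I
  norm_vec := by simp

/-- A complex square root of `i / v`, equal to `c i + d` for the matrix `frame u` below. -/
def rootDen (u : UnitTangent) : ℂ := (Complex.I / u.vec) ^ (1 / 2 : ℂ)

theorem rootDen_sq (u : UnitTangent) : u.rootDen ^ 2 = Complex.I / u.vec := by
  rw [rootDen, ← Complex.cpow_nat_mul]
  simp

theorem vec_ne_zero (u : UnitTangent) : u.vec ≠ 0 := by
  rw [← norm_pos_iff, u.norm_vec]; exact u.base.im_pos

theorem normSq_rootDen (u : UnitTangent) : Complex.normSq u.rootDen = 1 / u.base.im := by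
  rw [← Complex.sq_norm, ← norm_pow, rootDen_sq, norm_div, u.norm_vec]
  simp

/-- A matrix `g` such that `g • origin = u` (it is unique up to sign). -/
def frame (u : UnitTangent) : SL(2, ℝ) :=
  ⟨!![((u.base : ℂ) * u.rootDen).im, ((u.base : ℂ) * u.rootDen).re;
      u.rootDen.im, u.rootDen.re], by
    have h := normSq_rootDen u
    have hy := u.base.im_ne_zero
    rw [Complex.normSq_apply] at h
    simp only [Matrix.det_fin_two_of, Complex.mul_im, Complex.mul_re, UpperHalfPlane.coe_im,
      UpperHalfPlane.coe_re]
    field_simp at h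
    linear_combination h⟩

theorem den_frame (u : UnitTangent) : den u.frame UpperHalfPlane.I = u.rootDen := by
  apply Complex.ext <;> simp [den, frame]

theorem frame_smul_origin (u : UnitTangent) : u.frame • origin = u := by
  have h0 : u.rootDen ≠ 0 := by rw [← den_frame]; exact den_ne_zero _ _
  ext1
  · ext1
    change ((u.frame • UpperHalfPlane.I : ℍ) : ℂ) = u.base
    rw [coe_smul_eq, den_frame, div_eq_iff h0]
    apply Complex.ext <;> simp [frame]
  · change Complex.I / den u.frame UpperHalfPlane.I ^ 2 = u.vec
    rw [den_frame, rootDen_sq, div_div_cancel₀ Complex.I_ne_zero]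

/-- The stabilizer of `origin` is `{1, -1}`. -/
theorem eq_one_or_neg_one_of_smul_origin {g : SL(2, ℝ)} (h : g • origin = origin) :
    g = 1 ∨ g = -1 := by
  have hb : ((g • UpperHalfPlane.I : ℍ) : ℂ) = UpperHalfPlane.I :=
    congrArg (fun u : UnitTangent => (u.base : ℂ)) h
  have hv : Complex.I / den g UpperHalfPlane.I ^ 2 = Complex.I := congrArg UnitTangent.vec h
  have hn := den_ne_zero g UpperHalfPlane.I
  have h2 : den g UpperHalfPlane.I ^ 2 = 1 := by
    rw [div_eq_iff (pow_ne_zero 2 hn)] at hv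
    have := mul_left_cancel₀ Complex.I_ne_zero ((mul_one _).trans hv)
    exact this.symm
  rw [coe_smul_eq, div_eq_iff hn] at hb
  have hden : den g UpperHalfPlane.I = ((g 1 0 : ℝ) : ℂ) * Complex.I + ((g 1 1 : ℝ) : ℂ) := by
    simp [den]
  have hc : ∀ s : ℝ, den g UpperHalfPlane.I = (s : ℂ) →
      g 0 0 = s ∧ g 0 1 = 0 ∧ g 1 0 = 0 ∧ g 1 1 = s := by
    intro s hs
    rw [hs] at hb
    rw [hs] at hden
    have e1 := congrArg Complex.re hb
    have e2 := congrArg Complex.im hb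
    have e3 := congrArg Complex.re hden
    have e4 := congrArg Complex.im hden
    simp at e1 e2 e3 e4
    exact ⟨e2, e1, e4.symm, e3.symm⟩
  rcases (sq_eq_sq_iff_eq_or_eq_neg.mp (h2.trans (one_pow 2).symm)) with h1 | h1
  · obtain ⟨h00, h01, h10, h11⟩ := hc 1 (by simpa using h1)
    left
    ext i j
    fin_cases i <;> fin_cases j <;> simp [h00, h01, h10, h11]
  · obtain ⟨h00, h01, h10, h11⟩ := hc (-1) (by simpa using h1)
    right
    ext i j
    fin_cases i <;> fin_cases j <;> simp [h00, h01, h10, h11]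

/-- Right multiplication by `x`, transported to the unit tangent bundle through the
identification `± g ↦ g • origin` of `PSL(2, ℝ)` with it. -/
def rightMul (x : SL(2, ℝ)) (u : UnitTangent) : UnitTangent := (u.frame * x) • origin

theorem neg_smul_eq (g : SL(2, ℝ)) (u : UnitTangent) : (-g) • u = g • u := by
  ext1
  · ext1
    simp only [base_smul, coe_smul_eq, den]
    rw [← neg_div_neg_eq]
    congr 1 <;> simp <;> ring
  · simp only [vec_smul, den]
    congr 1
    simp
    ring

theorem rightMul_smul_origin (x g : SL(2, ℝ)) :
    rightMul x (g • origin) = (g * x) • origin := by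
  have h : (g⁻¹ * (g • origin).frame) • origin = origin := by
    rw [mul_smul, frame_smul_origin, inv_smul_smul]
  rcases eq_one_or_neg_one_of_smul_origin h with h | h
  · rw [rightMul, ← inv_mul_eq_one.mp h]
  · have h' : (g • origin).frame = -g := by
      rw [inv_mul_eq_iff_eq_mul] at h
      rw [h]; simp
    rw [rightMul, h', neg_mul, neg_smul_eq]

theorem rightMul_smul (x g : SL(2, ℝ)) (u : UnitTangent) :
    rightMul x (g • u) = g • rightMul x u := by
  have h : g • u = (g * u.frame) • origin := by rw [mul_smul, frame_smul_origin]
  rw [h, rightMul_smul_origin, rightMul, mul_assoc, mul_smul]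

theorem rightMul_rightMul (x y : SL(2, ℝ)) (u : UnitTangent) :
    rightMul y (rightMul x u) = rightMul (x * y) u := by
  rw [rightMul.eq_1 x, rightMul_smul_origin, mul_assoc, rightMul.eq_1 (x * y)]

/-- The matrix `diag (e ^ (t / 2), e ^ (- t / 2))`, acting on `ℍ` by `z ↦ e ^ t z`. -/
def diagMat (t : ℝ) : SL(2, ℝ) :=
  ⟨!![Real.exp (t / 2), 0; 0, Real.exp (-(t / 2))], by
    simp [Matrix.det_fin_two_of, ← Real.exp_add]⟩

/-- The unipotent matrix acting on `ℍ` by `z ↦ z + s`. -/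
def unipMat (s : ℝ) : SL(2, ℝ) := ⟨!![1, s; 0, 1], by simp [Matrix.det_fin_two_of]⟩

/-- The geodesic flow: `g_t (g • origin) = g • (i e ^ t, i e ^ t)`, so that
`t ↦ (g_t u).base` is the unit speed geodesic with initial vector `u`. -/
def geodesicFlow (t : ℝ) : UnitTangent → UnitTangent := rightMul (diagMat t)

/-- The horocycle flow: `h_s (g • origin) = g • (i + s, i)`, so that `s ↦ (h_s u).base` is
the horocycle through the base point of `u` centred at the endpoint of the geodesic ray
defined by `u`, parametrized by arc length. -/
def horocycleFlow (s : ℝ) : UnitTangent → UnitTangent := rightMul (unipMat s)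

end UnitTangent

/-! ### The surface `Γ \ ℍ` and its unit tangent bundle -/

section Surface

variable (Γ : Subgroup SL(2, ℝ))

/-- Fuchsian group without elliptic element, given by a subgroup of `SL(2, ℝ)` acting on `ℍ`
through its image in `PSL(2, ℝ)`. -/
structure IsFuchsianWithoutElliptic : Prop where
  discrete : DiscreteTopology Γ
  not_isElliptic : ∀ γ ∈ Γ, ¬ (γ : Matrix (Fin 2) (Fin 2) ℝ).IsElliptic

/-- The closed Dirichlet region centred at `z` cut out by the elements of `F`. -/
def dirichletRegion (F : Set SL(2, ℝ)) (z : ℍ) : Set ℍ :=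
  {w | ∀ γ ∈ F, dist w z ≤ dist w (γ • z)}

/-- `Γ` (acting on `ℍ` without elliptic elements) is geometrically finite: some Dirichlet domain
of `Γ` is a polygon with finitely many sides, that is, an intersection of finitely many of the
half-planes that define it. -/
def IsGeometricallyFinite : Prop :=
  ∃ z : ℍ, ∃ F : Set SL(2, ℝ), F.Finite ∧ F ⊆ Γ ∧
    dirichletRegion (Γ : Set SL(2, ℝ)) z = dirichletRegion F z

/-- The hyperbolic surface `Σ = Γ \ ℍ`. -/
abbrev Surface : Type := Quotient (MulAction.orbitRel Γ ℍ)

/-- The unit tangent bundle `T¹Σ = Γ \ T¹ℍ`, with the quotient topology. -/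
abbrev UnitTangentBundle : Type := Quotient (MulAction.orbitRel Γ UnitTangent)

/-- The canonical projection `T¹Σ → Σ`. -/
def proj : UnitTangentBundle Γ → Surface Γ :=
  Quotient.map UnitTangent.base (by
    rintro _ u ⟨γ, rfl⟩
    exact ⟨γ, rfl⟩)

/-- The map of `T¹Σ` induced by `UnitTangent.rightMul x`. -/
def rightMul (x : SL(2, ℝ)) : UnitTangentBundle Γ → UnitTangentBundle Γ :=
  Quotient.map (UnitTangent.rightMul x) (by
    rintro _ u ⟨γ, rfl⟩
    exact ⟨γ, (UnitTangent.rightMul_smul x γ u).symm⟩)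

/-- The geodesic flow on `T¹Σ`. -/
def geodesicFlow (t : ℝ) : UnitTangentBundle Γ → UnitTangentBundle Γ :=
  rightMul Γ (UnitTangent.diagMat t)

/-- The horocycle flow on `T¹Σ`. -/
def horocycleFlow (s : ℝ) : UnitTangentBundle Γ → UnitTangentBundle Γ :=
  rightMul Γ (UnitTangent.unipMat s)

/-- The injectivity radius of `Σ` at `x`: half of the infimum of `d(z, γ z)` over the lifts `z`
of `x` and the elements `γ` of `Γ` with nontrivial image in `PSL(2, ℝ)`. -/
def injectivityRadius (x : Surface Γ) : ℝ≥0∞ :=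
  (⨅ (z : ℍ) (_ : (Quotient.mk _ z : Surface Γ) = x) (γ ∈ Γ) (_ : γ ≠ 1 ∧ γ ≠ -1),
    edist z (γ • z)) / 2

/-- The asymptotic thinness `Inj(u(ℝ₊))`: the lower limit of the injectivity radius along the
geodesic ray defined by `u`. -/
def asymptoticThinness (u : UnitTangentBundle Γ) : ℝ≥0∞ :=
  Filter.liminf (fun t : ℝ => injectivityRadius Γ (proj Γ (geodesicFlow Γ t u))) Filter.atTop

end Surface

end Horo

end

/-! The dichotomy is topological dynamics. Suppose that the closure of the orbit of `x` is minimal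
but `x` is not recurrent: some neighbourhood `U` of `x` meets the orbit only at times in `[-T, T]`.
The orbit is not closed, so its closure contains some `v` off the orbit, and by minimality the orbit
of `v` accumulates at `x`, hence enters the interior of `U`. The point where it does so is a limit
of points of the orbit of `x` lying in `U`, that is, of points of the piece with times in `[-T, T]`.
That piece is closed, so `v` lies on the orbit of `x`, a contradiction
(`isRecurrent_of_isMinimalSet_closure_orbit`). The geometric input is that bounded horocyclic pieces
are closed (`isClosed_horocycleFlow_image_Icc`): their preimage in `SL(2, ℝ)` is the product of the
discrete, hence closed, subgroup `Γ` and a compact set. -/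

open scoped Pointwise

namespace Horo

/-! ### Recurrence from minimality. -/

section Dynamics

variable {X : Type*} [TopologicalSpace X] {φ : ℝ → X → X}

/-- If bounded pieces of the orbit of `x` are closed, and the orbit of `x` is not closed but has
minimal closure, then `x` is recurrent. -/
theorem isRecurrent_of_isMinimalSet_closure_orbit (hcont : ∀ t, Continuous (φ t))
    (hzero : ∀ x, φ 0 x = x) (hadd : ∀ s t x, φ s (φ t x) = φ (t + s) x) {x : X}
    (hpiece : ∀ T : ℝ, IsClosed ((fun t => φ t x) '' Set.Icc (-T) T))
    (hnot : ¬ IsClosed (orbit φ x)) (hmin : IsMinimalSet φ (closure (orbit φ x))) :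
    IsRecurrent φ x := by
  by_contra hrec
  simp only [IsRecurrent, not_forall, not_exists, not_and] at hrec
  obtain ⟨U, hU, T, hT⟩ := hrec
  obtain ⟨v, hv, hvx⟩ : ∃ v ∈ closure (orbit φ x), v ∉ orbit φ x := by
    by_contra! h
    exact hnot (closure_subset_iff_isClosed.mp h)
  have hinv : IsInvariant φ (closure (orbit φ v)) := fun t =>
    Set.MapsTo.closure (by rintro _ ⟨s, rfl⟩; exact ⟨s + t, (hadd t s v).symm⟩) (hcont t)
  have hsub : closure (orbit φ v) ⊆ closure (orbit φ x) := by
    refine closure_minimal ?_ isClosed_closure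
    rintro _ ⟨s, rfl⟩
    exact hmin.invariant s hv
  have heq : closure (orbit φ v) = closure (orbit φ x) := hmin.eq_of_subset _ isClosed_closure
    (Set.Nonempty.closure ⟨_, Set.mem_range_self 0⟩) hinv hsub
  have hxv : x ∈ closure (orbit φ v) := by
    rw [heq]
    exact subset_closure ⟨0, hzero x⟩
  -- The interior is used because an open set meets a closure `closure A` only inside the closure of
  -- its intersection with `A`.
  obtain ⟨_, hsU, s, rfl⟩ := mem_closure_iff_nhds.mp hxv _ (interior_mem_nhds.mpr hU)
  have hmem : φ s v ∈ (fun t => φ t x) '' Set.Icc (-T) T := by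
    rw [← (hpiece T).closure_eq]
    refine closure_mono ?_ (isOpen_interior.inter_closure ⟨hsU, hmin.invariant s hv⟩)
    rintro _ ⟨htU, t, rfl⟩
    refine ⟨t, abs_le.mp ?_, rfl⟩
    by_contra! h
    exact hT t h.le (interior_subset htU)
  obtain ⟨t, -, ht⟩ := hmem
  refine hvx ⟨t + -s, ?_⟩
  change φ (t + -s) x = v
  rw [← hadd, show φ t x = φ s v from ht, hadd, add_neg_cancel, hzero]

end Dynamics

/-! ### The unit tangent bundle as a topological quotient of `SL(2, ℝ)`. -/

namespace UnitTangent

theorem isInducing_base_vec :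
    Topology.IsInducing fun u : UnitTangent => (u.base, u.vec) := ⟨rfl⟩

theorem continuous_base : Continuous base :=
  continuous_fst.comp isInducing_base_vec.continuous

theorem continuous_vec : Continuous vec :=
  continuous_snd.comp isInducing_base_vec.continuous

theorem isInducing_coe_matrix :
    Topology.IsInducing fun g : SL(2, ℝ) => (g : Matrix (Fin 2) (Fin 2) ℝ) := ⟨rfl⟩

theorem continuous_entry (i j : Fin 2) : Continuous fun g : SL(2, ℝ) => g i j :=
  continuous_subtype_val.matrix_elem i j

theorem continuous_den : Continuous fun p : SL(2, ℝ) × ℍ => den p.1 p.2 := by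
  unfold den
  have h0 := (continuous_entry 1 0).comp (continuous_fst (X := SL(2, ℝ)) (Y := ℍ))
  have h1 := (continuous_entry 1 1).comp (continuous_fst (X := SL(2, ℝ)) (Y := ℍ))
  have h2 := UpperHalfPlane.continuous_coe.comp (continuous_snd (X := SL(2, ℝ)) (Y := ℍ))
  exact ((Complex.continuous_ofReal.comp h0).mul h2).add (Complex.continuous_ofReal.comp h1)

theorem continuous_smul_upperHalfPlane :
    Continuous fun p : SL(2, ℝ) × ℍ => p.1 • p.2 := by
  rw [UpperHalfPlane.isEmbedding_coe.continuous_iff]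
  change Continuous fun p : SL(2, ℝ) × ℍ => ((p.1 • p.2 : ℍ) : ℂ)
  simp only [coe_smul_eq]
  have h0 := (continuous_entry 0 0).comp (continuous_fst (X := SL(2, ℝ)) (Y := ℍ))
  have h1 := (continuous_entry 0 1).comp (continuous_fst (X := SL(2, ℝ)) (Y := ℍ))
  have h2 := UpperHalfPlane.continuous_coe.comp (continuous_snd (X := SL(2, ℝ)) (Y := ℍ))
  exact (((Complex.continuous_ofReal.comp h0).mul h2).add
    (Complex.continuous_ofReal.comp h1)).div continuous_den fun p => den_ne_zero _ _

instance : ContinuousSMul SL(2, ℝ) UnitTangent where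
  continuous_smul := by
    have hb : Continuous fun p : SL(2, ℝ) × UnitTangent => (p.1, p.2.base) :=
      continuous_fst.prodMk (continuous_base.comp continuous_snd)
    rw [isInducing_base_vec.continuous_iff]
    exact (continuous_smul_upperHalfPlane.comp hb).prodMk
      ((continuous_vec.comp continuous_snd).div ((continuous_den.comp hb).pow 2)
        fun p => pow_ne_zero 2 (den_ne_zero _ _))

theorem frame_origin : frame origin = 1 := by
  have h : rootDen origin = 1 := by simp [rootDen, origin]
  ext i j
  fin_cases i <;> fin_cases j <;> simp [frame, h] <;> simp [origin]

/-- Continuity is only local: the principal square root in `rootDen` jumps, and `frame` changes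
sign, where `I / vec` crosses the negative real axis. At `origin` this quotient is `1`. -/
theorem continuousAt_frame_origin : ContinuousAt frame origin := by
  have hr : ContinuousAt rootDen origin := by
    refine ContinuousAt.cpow (continuousAt_const.div continuous_vec.continuousAt
      (vec_ne_zero _)) continuousAt_const ?_
    simp [origin]
  have hb : ContinuousAt (fun u : UnitTangent => (u.base : ℂ)) origin :=
    (UpperHalfPlane.continuous_coe.comp continuous_base).continuousAt
  have hm := hb.mul hr
  rw [isInducing_coe_matrix.continuousAt_iff]
  refine continuousAt_pi.mpr fun i => continuousAt_pi.mpr fun j => ?_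
  fin_cases i <;> fin_cases j
  · exact Complex.continuous_im.continuousAt.comp hm
  · exact Complex.continuous_re.continuousAt.comp hm
  · exact Complex.continuous_im.continuousAt.comp hr
  · exact Complex.continuous_re.continuousAt.comp hr

/-- Allows continuity and closedness to be tested on the group, where the flows are right
multiplications. -/
theorem isOpenQuotientMap_smul_origin :
    IsOpenQuotientMap fun g : SL(2, ℝ) => g • origin where
  surjective u := ⟨u.frame, frame_smul_origin u⟩
  continuous := continuous_id.smul continuous_const
  isOpenMap := by
    -- Left translation by `g` carries the section `frame`, continuous at `origin`, to one through
    -- `g` continuous at `g • origin`.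
    refine IsOpenMap.of_sections fun g => ⟨fun u => g * frame (g⁻¹ • u), ?_, ?_, fun u => ?_⟩
    · refine continuousAt_const.mul (ContinuousAt.comp (g := frame) ?_ (continuous_const_smul g⁻¹).continuousAt)
      rw [inv_smul_smul]
      exact continuousAt_frame_origin
    · simp [frame_origin]
    · change (g * frame (g⁻¹ • u)) • origin = u
      rw [mul_smul, frame_smul_origin, smul_inv_smul]

theorem continuous_rightMul (x : SL(2, ℝ)) : Continuous (rightMul x) := by
  rw [isOpenQuotientMap_smul_origin.isQuotientMap.continuous_iff]
  have : rightMul x ∘ (fun g : SL(2, ℝ) => g • origin) = fun g => (g * x) • origin :=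
    funext fun g => rightMul_smul_origin x g
  rw [this]
  exact (continuous_mul_const x).smul continuous_const

theorem rightMul_one (u : UnitTangent) : rightMul 1 u = u := by
  rw [rightMul, mul_one, frame_smul_origin]

theorem unipMat_zero : unipMat 0 = 1 := by
  ext i j
  fin_cases i <;> fin_cases j <;> simp [unipMat]

theorem unipMat_mul (s t : ℝ) : unipMat s * unipMat t = unipMat (s + t) := by
  apply Subtype.ext
  change !![1, s; 0, 1] * !![1, t; 0, 1] = !![1, s + t; 0, 1]
  simp [add_comm]

theorem continuous_unipMat : Continuous unipMat := by
  rw [isInducing_coe_matrix.continuous_iff]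
  refine continuous_pi fun i => continuous_pi fun j => ?_
  fin_cases i <;> fin_cases j
  · exact continuous_const
  · exact continuous_id
  · exact continuous_const
  · exact continuous_const

end UnitTangent

/-! ### The horocycle flow on the quotient by `Γ`. -/

section Surface

open UnitTangent

variable (Γ : Subgroup SL(2, ℝ))

theorem continuous_horocycleFlow (s : ℝ) : Continuous (horocycleFlow Γ s) :=
  (continuous_quot_mk.comp (continuous_rightMul _)).quotient_lift _

theorem horocycleFlow_zero (u : UnitTangentBundle Γ) : horocycleFlow Γ 0 u = u := by
  induction u using Quotient.inductionOn with
  | h u =>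
    change (Quotient.mk _ (UnitTangent.rightMul (unipMat 0) u) : UnitTangentBundle Γ) = _
    rw [unipMat_zero, rightMul_one]

theorem horocycleFlow_horocycleFlow (s t : ℝ) (u : UnitTangentBundle Γ) :
    horocycleFlow Γ s (horocycleFlow Γ t u) = horocycleFlow Γ (t + s) u := by
  induction u using Quotient.inductionOn with
  | h u =>
    change (Quotient.mk _ (UnitTangent.rightMul (unipMat s) (UnitTangent.rightMul (unipMat t) u)) :
      UnitTangentBundle Γ) = Quotient.mk _ (UnitTangent.rightMul (unipMat (t + s)) u)
    rw [rightMul_rightMul, unipMat_mul]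

theorem smul_origin_eq_iff {g h : SL(2, ℝ)} :
    g • origin = h • origin ↔ g = h ∨ g = -h := by
  constructor
  · intro e
    have e' : (h⁻¹ * g) • origin = origin := by rw [mul_smul, e, inv_smul_smul]
    rcases eq_one_or_neg_one_of_smul_origin e' with e' | e'
    · exact Or.inl (inv_mul_eq_one.mp e').symm
    · right
      rw [inv_mul_eq_iff_eq_mul] at e'
      rw [e', mul_neg, mul_one]
  · rintro (rfl | rfl)
    · rfl
    · exact neg_smul_eq _ _

/-- When `Γ` is discrete, bounded pieces of horocyclic orbits are closed. -/
theorem isClosed_horocycleFlow_image_Icc [DiscreteTopology Γ] (u : UnitTangentBundle Γ)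
    (a b : ℝ) : IsClosed ((fun s => horocycleFlow Γ s u) '' Set.Icc a b) := by
  obtain ⟨u, rfl⟩ := Quotient.exists_rep u
  obtain ⟨g, rfl⟩ := isOpenQuotientMap_smul_origin.surjective u
  have hq : Topology.IsQuotientMap
      fun k : SL(2, ℝ) => (Quotient.mk _ (k • origin) : UnitTangentBundle Γ) :=
    isQuotientMap_quot_mk.comp isOpenQuotientMap_smul_origin.isQuotientMap
  rw [← hq.isClosed_preimage]
  have hK : IsCompact ((fun s => g * unipMat s) '' Set.Icc a b) :=
    isCompact_Icc.image (continuous_const.mul continuous_unipMat)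
  -- Both signs appear since the fibres over the unit tangent bundle are pairs `±k`, and `Γ` need
  -- not contain `-1`.
  have hclosed : IsClosed ((Γ : Set SL(2, ℝ)) * ((fun s => g * unipMat s) '' Set.Icc a b ∪
      (fun s => -(g * unipMat s)) '' Set.Icc a b)) := by
    refine IsClosed.mul_right_of_isCompact Γ.isClosed_of_discrete
      (hK.union (isCompact_Icc.image ?_))
    simp only [← neg_mul]
    exact continuous_const.mul continuous_unipMat
  convert hclosed using 1
  ext k
  have hflow : ∀ s, horocycleFlow Γ s (Quotient.mk _ (g • origin)) =
      Quotient.mk _ ((g * unipMat s) • origin) := fun s =>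
    congrArg (Quotient.mk _) (rightMul_smul_origin _ _)
  simp only [Set.mem_preimage, Set.mem_image, hflow, Set.mem_mul, SetLike.mem_coe]
  constructor
  · rintro ⟨s, hs, e⟩
    obtain ⟨γ, e⟩ := Quotient.exact e.symm
    have e : (γ : SL(2, ℝ)) • (g * unipMat s) • origin = k • origin := e
    rw [← mul_smul, eq_comm, smul_origin_eq_iff] at e
    rcases e with rfl | rfl
    · exact ⟨γ, γ.2, _, Or.inl ⟨s, hs, rfl⟩, rfl⟩
    · refine ⟨γ, γ.2, -(g * unipMat s), Or.inr ⟨s, hs, rfl⟩, mul_neg _ _⟩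
  · rintro ⟨γ, hγ, m, hm, rfl⟩
    obtain ⟨s, hs, hm⟩ : ∃ s ∈ Set.Icc a b, m • origin = (g * unipMat s) • origin := by
      rcases hm with ⟨s, hs, rfl⟩ | ⟨s, hs, rfl⟩
      · exact ⟨s, hs, rfl⟩
      · exact ⟨s, hs, smul_origin_eq_iff.mpr (Or.inr rfl)⟩
    refine ⟨s, hs, Eq.symm (Quotient.sound ⟨⟨γ, hγ⟩, ?_⟩)⟩
    change γ • (g * unipMat s) • origin = (γ * m) • origin
    rw [mul_smul γ m, hm]

end Surface

end Horo

theorem mainTheorem1 (Γ : Subgroup (Matrix.SpecialLinearGroup (Fin 2) ℝ))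
    (hΓ : Horo.IsFuchsianWithoutElliptic Γ)
    (hinf : ¬ Horo.IsGeometricallyFinite Γ)
    (u₀ : Horo.UnitTangentBundle Γ)
    (hu₀ : u₀ ∈ Horo.nonwanderingSet (Horo.horocycleFlow Γ))
    (hirr : Horo.IsIrregularOrbit (Horo.horocycleFlow Γ) u₀)
    (hthin : Horo.asymptoticThinness Γ u₀ = ⊤) :
    Horo.IsRecurrent (Horo.horocycleFlow Γ) u₀ ∨
      ¬ Horo.IsMinimalSet (Horo.horocycleFlow Γ)
        (closure (Horo.orbit (Horo.horocycleFlow Γ) u₀)) := by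
  have := hΓ.discrete
  refine or_iff_not_imp_right.mpr fun hmin => ?_
  exact Horo.isRecurrent_of_isMinimalSet_closure_orbit (Horo.continuous_horocycleFlow Γ)
    (Horo.horocycleFlow_zero Γ) (Horo.horocycleFlow_horocycleFlow Γ)
    (fun T => Horo.isClosed_horocycleFlow_image_Icc Γ u₀ (-T) T) hirr.1 (not_not.mp hmin)
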